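/- Let $p$ be a prime, $d\in\mathbb N$, and let $\varepsilon_p\in\mathbb C$ be a primitive $p$-th root of unity. **Setting.** Let $\mathfrak A=\bigotimes_{x\in\mathbb Z^d}M_p(\mathbb C)$ be the quasi-local C*-algebra (the C*-inductive limit of the local algebras $\mathfrak A(U)=\bigotimes_{x\in U}M_p(\mathbb C)$, $U\subset\mathbb Z^d$ finite), with lattice translations $\tau_x$, which map an operator at cell $y$ to the same operator at cell $y+x$. Let $D_{p,d}$ be the ring of finitely supported functions $\mathbb Z^d\to\mathbb F_p$ with the convolution $f\star g=\sum_x f(x)\,\tau_x g$, where $(\tau_x g)(y)=g(y-x)$. The phase space is $\Xi_{p,d}=D_{p,d}^2$, with elements $\xi=(\xi_+,\xi_-)$, translations $(\tau_y\xi)(x)=\xi(x-y)$, and $$\beta(\xi,\eta)=-\sum_{x\in\mathbb Z^d}\xi_+(x)\,\eta_-(x),\qquad \sigma(\xi,\eta)=\beta(\xi,\eta)-\beta(\eta,\xi)\in\mathbb F_p .$$ The Weyl operators are $w(\xi)=\bigotimes_{x}w(\xi_+(x),\xi_-(x))\in\mathfrak A$, where on $\mathbb C^p$ with basis $|q\rangle$,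 $q\in\mathbb F_p$, one puts $w(a,b)|q\rangle=\varepsilon_p^{aq}|q+b\rangle$ for $a,b\in\mathbb F_p$. They satisfy $w(\xi+\eta)=\varepsilon_p^{\beta(\xi,\eta)}w(\xi)w(\eta)$. A Clifford quantum cellular automaton (CQCA) is a *-automorphism $\alpha$ of $\mathfrak A$ such that: (i) there is a finite set $N\subset\mathbb Z^d$ with $\alpha(\mathfrak A(\{x\}))\subset\mathfrak A(N+x)$ for all $x\in\mathbb Z^d$; (ii) $\alpha\circ\tau_x=\tau_x\circ\alpha$ for all $x\in\mathbb Z^d$; (iii) $\alpha$ maps every Weyl operator to a multiple of a Weyl operator. **Theorem.** For each CQCA $\alpha$ there exist a matrix $s\in M_2(D_{p,d})$ and a translation-invariant function $\varphi\colon D_{p,d}^2\to U(1)$ (that is, $\varphi(\tau_x\xi)=\varphi(\xi)$ for all $x$ and $\xi$) such that for all $\xi,\eta\in D_{p,d}^2$ $$\alpha(w(\xi))=\varphi(\xi)\,w(s\star\xi),$$ $$\varphi(\xi+\eta)=\varepsilon_p^{\beta(\xi,\eta)-\beta(s\star\xi,s\star\eta)}\,\varphi(\xi)\,\varphi(\eta),$$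 where $(s\star\xi)_i=\sum_j s_{ij}\star\xi_j$. Moreover, $s\star$ preserves the symplectic form: $\sigma(s\star\xi,s\star\eta)=\sigma(\xi,\eta)$ for all $\xi,\eta\in D_{p,d}^2$. -/

import Mathlib

open scoped BigOperators

noncomputable section

namespace CQCA

/-! ### The lattice, configurations and the Hilbert space carrying the local algebras -/

/-- The cubic lattice `ℤ^d`. -/
abbrev Lattice (d : ℕ) : Type := Fin d → ℤ

/-- Classical configurations: functions from the lattice to `𝔽_p = ℤ/p`. -/
abbrev Config (p d : ℕ) : Type := Lattice d → ZMod p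

/-- The Hilbert space with an orthonormal basis `|q⟩` labelled by the configurations `q`. All local
algebras act on it faithfully; its only role is to realise the infinite tensor product of the cell
algebras (the C*-inductive limit of the local algebras) concretely as an algebra of operators. -/
abbrev Hilb (p d : ℕ) : Type := lp (fun _ : Config p d => ℂ) 2

/-- Bounded operators on `Hilb p d`. -/
abbrev Op (p d : ℕ) : Type := Hilb p d →L[ℂ] Hilb p d

variable {p d : ℕ}

/-- The unitary that permutes the basis, `|q⟩ ↦ |e q⟩`. -/
def permute (e : Config p d ≃ Config p d) : Hilb p d ≃ₗᵢ[ℂ] Hilb p d where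
  toFun f := ⟨fun q => f (e.symm q), by
    have h := (lp.memℓp f).summable (by norm_num)
    exact memℓp_gen (e.symm.summable_iff.2 h)⟩
  invFun f := ⟨fun q => f (e q), by
    have h := (lp.memℓp f).summable (by norm_num)
    exact memℓp_gen (e.summable_iff.2 h)⟩
  map_add' f g := by ext q; rfl
  map_smul' c f := by ext q; rfl
  left_inv f := by ext q; simp
  right_inv f := by ext q; simp
  norm_map' f := by
    have h2 : (0 : ℝ) < (2 : ENNReal).toReal := by norm_num
    rw [lp.norm_eq_tsum_rpow h2, lp.norm_eq_tsum_rpow h2]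
    congr 1
    exact e.symm.tsum_eq (fun q => ‖f q‖ ^ (2 : ENNReal).toReal)

theorem memℓp_diagonal {a : Config p d → ℂ} {C : ℝ} (ha : ∀ q, ‖a q‖ ≤ C) (f : Hilb p d) :
    Memℓp (fun q => a q * f q) 2 := by
  have h := ((lp.memℓp f).summable (by norm_num)).mul_left (|C| ^ (2 : ENNReal).toReal)
  refine memℓp_gen (h.of_nonneg_of_le (fun q => by positivity) fun q => ?_)
  rw [← Real.mul_rpow (abs_nonneg C) (norm_nonneg _), norm_mul]
  exact Real.rpow_le_rpow (by positivity)
    (mul_le_mul_of_nonneg_right ((ha q).trans (le_abs_self C)) (norm_nonneg _)) (by norm_num)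

/-- The diagonal operator `|q⟩ ↦ a(q) |q⟩` for a bounded function `a`, as a linear map. -/
def diagonalLinear (a : Config p d → ℂ) (C : ℝ) (ha : ∀ q, ‖a q‖ ≤ C) :
    Hilb p d →ₗ[ℂ] Hilb p d where
  toFun f := ⟨fun q => a q * f q, memℓp_diagonal ha f⟩
  map_add' f g := by ext q; exact mul_add _ _ _
  map_smul' c f := by ext q; exact mul_left_comm _ _ _

theorem norm_diagonalLinear_le (a : Config p d → ℂ) (C : ℝ) (ha : ∀ q, ‖a q‖ ≤ C)
    (f : Hilb p d) : ‖diagonalLinear a C ha f‖ ≤ |C| * ‖f‖ := by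
  have h2 : (2 : ENNReal) ≠ 0 := by norm_num
  have h : ‖(C : ℂ) • f‖ = |C| * ‖f‖ := by
    rw [norm_smul, Complex.norm_real, Real.norm_eq_abs]
  rw [← h]
  refine lp.norm_mono h2 (fun q => ?_)
  change ‖a q * f q‖ ≤ ‖(C : ℂ) * f q‖
  rw [norm_mul, norm_mul, Complex.norm_real]
  exact mul_le_mul_of_nonneg_right ((ha q).trans (le_abs_self C)) (norm_nonneg _)

/-- The diagonal operator `|q⟩ ↦ a(q) |q⟩` for a bounded function `a`. -/
def diagonal (a : Config p d → ℂ) (C : ℝ) (ha : ∀ q, ‖a q‖ ≤ C) : Op p d :=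
  (diagonalLinear a C ha).mkContinuous |C| (norm_diagonalLinear_le a C ha)

/-! ### Local algebras `𝔄(U) = ⨂_{x ∈ U} M_p(ℂ)` -/

/-- Configurations of the finite region `U`. -/
abbrev LocalConfig (p : ℕ) {d : ℕ} (U : Finset (Lattice d)) : Type := U → ZMod p

/-- `⨂_{x ∈ U} M_p(ℂ)`, as the algebra of matrices indexed by the configurations of `U`. -/
abbrev LocalMatrix (p : ℕ) {d : ℕ} (U : Finset (Lattice d)) : Type :=
  Matrix (LocalConfig p U) (LocalConfig p U) ℂ

/-- The elementary tensor `⨂_{x ∈ U} A_x`. -/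
def tensor (U : Finset (Lattice d)) (A : Lattice d → Matrix (ZMod p) (ZMod p) ℂ) :
    LocalMatrix p U :=
  Matrix.of fun r r' => ∏ x : U, A x (r x) (r' x)

/-- Restriction of a configuration to `U`. -/
def restrict (U : Finset (Lattice d)) (q : Config p d) : LocalConfig p U := fun x => q x

/-- The configuration that equals `r` on `U` and `q` outside of `U`. -/
def override (U : Finset (Lattice d)) (q : Config p d) (r : LocalConfig p U) : Config p d :=
  fun x => if h : x ∈ U then r ⟨x, h⟩ else q x

theorem restrict_override (U : Finset (Lattice d)) (q : Config p d) (r : LocalConfig p U) :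
    restrict U (override U q r) = r := by
  funext x; simp [restrict, override]

theorem override_override (U : Finset (Lattice d)) (q : Config p d) (r t : LocalConfig p U) :
    override U (override U q r) t = override U q t := by
  funext x; by_cases h : x ∈ U <;> simp [override, h]

theorem override_restrict (U : Finset (Lattice d)) (q : Config p d) :
    override U q (restrict U q) = q := by
  funext x; by_cases h : x ∈ U <;> simp [restrict, override, h]

/-- The permutation of the configurations that adds `s` on `U`. -/
def addOn (U : Finset (Lattice d)) (s : LocalConfig p U) : Config p d ≃ Config p d :=
  Equiv.addRight (override U 0 s)

theorem addOn_apply (U : Finset (Lattice d)) (s : LocalConfig p U) (q : Config p d) :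
    addOn U s q = override U q (restrict U q + s) := by
  funext x; by_cases h : x ∈ U <;> simp [addOn, restrict, override, h]

variable [Fact p.Prime]

/-- The operator `M ⊗ 1`, where `M` acts on the cells in `U`; see `ampliate_apply`. -/
def ampliate (U : Finset (Lattice d)) (M : LocalMatrix p U) : Op p d :=
  ∑ s : LocalConfig p U,
    (diagonal (fun q => M (restrict U q) (restrict U q + s)) (∑ r, ∑ r', ‖M r r'‖) (fun q =>
      (Finset.single_le_sum (f := fun r' => ‖M (restrict U q) r'‖)
        (fun _ _ => norm_nonneg _) (Finset.mem_univ _)).trans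
      (Finset.single_le_sum (f := fun r => ∑ r', ‖M r r'‖)
        (fun _ _ => Finset.sum_nonneg fun _ _ => norm_nonneg _) (Finset.mem_univ _)))).comp
    ((permute (addOn U s)).symm : Hilb p d →L[ℂ] Hilb p d)

/-- `M ⊗ 1` multiplies the tensor factors in `U` by `M` and leaves the others alone. -/
theorem ampliate_apply (U : Finset (Lattice d)) (M : LocalMatrix p U) (f : Hilb p d)
    (q : Config p d) :
    ampliate U M f q = ∑ r : LocalConfig p U, M (restrict U q) r * f (override U q r) := by
  have h1 : ampliate U M f q
      = ∑ s : LocalConfig p U, M (restrict U q) (restrict U q + s) * f (addOn U s q) := by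
    rw [ampliate, sum_apply, lp.coeFn_sum, Finset.sum_apply]
    rfl
  rw [h1, ← Equiv.sum_comp (Equiv.addLeft (restrict U q))
    (fun r => M (restrict U q) r * f (override U q r))]
  exact Finset.sum_congr rfl fun s _ => by rw [addOn_apply]; rfl

open Classical in
theorem ampliate_single (U : Finset (Lattice d)) (M : LocalMatrix p U) (q : Config p d) :
    ampliate U M (lp.single 2 q (1 : ℂ))
      = ∑ r : LocalConfig p U, M r (restrict U q) • lp.single 2 (override U q r) (1 : ℂ) := by
  ext q'
  rw [ampliate_apply, lp.coeFn_sum, Finset.sum_apply]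
  simp only [lp.coeFn_smul, Pi.smul_apply, lp.single_apply, Pi.single_apply, smul_eq_mul, mul_ite,
    mul_one, mul_zero]
  by_cases h : q' = override U q (restrict U q')
  · rw [Finset.sum_eq_single (restrict U q), Finset.sum_eq_single (restrict U q')]
    · rw [if_pos h, if_pos]
      rw [h, override_override, override_restrict]
    · intro r _ hr
      rw [if_neg]
      intro h'
      exact hr (by rw [h', restrict_override])
    · simp
    · intro r _ hr
      rw [if_neg]
      intro h'
      exact hr (by rw [← h', restrict_override])
    · simp
  · rw [Finset.sum_eq_zero, Finset.sum_eq_zero]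
    · intro r _
      rw [if_neg]
      intro h'
      exact h (by rw [h', restrict_override])
    · intro r _
      rw [if_neg]
      intro h'
      exact h (by rw [← h', override_override, override_restrict])

/-- The embedding `M ↦ M ⊗ 1` of `⨂_{x ∈ U} M_p(ℂ)` into the bounded operators: the tensor positions
outside of `U` are filled with the unit operator. -/
def localEmbed (U : Finset (Lattice d)) : LocalMatrix p U →⋆ₐ[ℂ] Op p d where
  toFun := ampliate U
  map_one' := by
    ext f q
    rw [ampliate_apply]
    simp [Matrix.one_apply, override_restrict]
  map_mul' M N := by
    ext f q
    rw [mul_apply_eq_comp, ampliate_apply, ampliate_apply]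
    simp only [ampliate_apply, restrict_override, override_override, Matrix.mul_apply,
      Finset.sum_mul, Finset.mul_sum]
    rw [Finset.sum_comm]
    simp only [mul_assoc]
  map_zero' := by
    ext f q
    rw [ampliate_apply]
    simp
  map_add' M N := by
    ext f q
    rw [add_apply, lp.coeFn_add, Pi.add_apply]
    simp only [ampliate_apply, Matrix.add_apply, add_mul, Finset.sum_add_distrib]
  commutes' c := by
    ext f q
    rw [ampliate_apply]
    simp [Matrix.algebraMap_matrix_apply, override_restrict, Algebra.algebraMap_eq_smul_one]
  map_star' M := by
    classical
    ext f q
    have h1 : ∀ g : Hilb p d, inner ℂ (lp.single 2 q (1 : ℂ)) g = g q := fun g => by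
      rw [lp.inner_single_left]; simp
    rw [← h1 (star (ampliate U M) f), ContinuousLinearMap.star_eq_adjoint,
      ContinuousLinearMap.adjoint_inner_right, ampliate_single, sum_inner, ampliate_apply]
    refine Finset.sum_congr rfl fun r _ => ?_
    rw [inner_smul_left, lp.inner_single_left]
    simp [Matrix.star_apply]

/-- The local algebra `𝔄(U)`: the operators localized in the finite region `U`. -/
def localAlgebra (p : ℕ) {d : ℕ} [Fact p.Prime] (U : Finset (Lattice d)) :
    StarSubalgebra ℂ (Op p d) :=
  (localEmbed U).range

/-- The embedding of `⨂_{x ∈ U} M_p(ℂ)` is faithful. -/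
theorem localEmbed_injective (U : Finset (Lattice d)) :
    Function.Injective (localEmbed (p := p) U) := by
  classical
  intro M N h
  ext r r'
  have h1 : ∀ L : LocalMatrix p U, ampliate U L (lp.single 2 (override U 0 r') (1 : ℂ))
      (override U 0 r) = L r r' := fun L => by
    rw [ampliate_apply, Finset.sum_eq_single r']
    · rw [restrict_override, override_override, lp.single_apply_self, mul_one]
    · intro t _ ht
      rw [override_override, lp.single_apply_ne, mul_zero]
      intro h'
      exact ht (by rw [← restrict_override U 0 t, h', restrict_override])
    · simp
  rw [← h1 M, ← h1 N]
  exact congrArg (fun T : Op p d => T (lp.single 2 (override U 0 r') (1 : ℂ)) (override U 0 r)) h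

/-- The local algebras form an increasing net, so that their union is a *-algebra. -/
theorem localAlgebra_mono {U V : Finset (Lattice d)} (hUV : U ⊆ V) :
    localAlgebra p U ≤ localAlgebra p V := by
  classical
  rintro _ ⟨M, rfl⟩
  refine ⟨Matrix.of fun r r' => if ∀ x : V, (x : Lattice d) ∉ U → r x = r' x then
    M (fun x => r ⟨x, hUV x.2⟩) (fun x => r' ⟨x, hUV x.2⟩) else 0, ?_⟩
  ext f q
  change ampliate _ _ f q = ampliate U M f q
  rw [ampliate_apply, ampliate_apply]
  symm
  refine Finset.sum_of_injOn (fun r => restrict V (override U q r)) ?_ (by simp) ?_ ?_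
  · intro r _ t _ h
    funext x
    have := congrFun h ⟨x, hUV x.2⟩
    simpa [restrict, override] using this
  · intro r' _ hr'
    rw [Matrix.of_apply, if_neg, zero_mul]
    intro h
    refine hr' ⟨fun x => r' ⟨x, hUV x.2⟩, by simp, ?_⟩
    funext x
    by_cases hx : (x : Lattice d) ∈ U
    · simp [restrict, override, hx]
    · simpa [restrict, override, hx] using h x hx
  · intro r _
    rw [Matrix.of_apply, if_pos]
    · congr 2
      · funext x; simp [restrict, override]
      · refine congrArg (f : Config p d → ℂ) ?_
        funext x
        by_cases hx : x ∈ U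
        · simp [restrict, override, hx, hUV hx]
        · by_cases hx' : x ∈ V <;> simp [restrict, override, hx, hx']
    · intro x hx
      simp [restrict, override, hx]

/-- The quasi-local algebra: the norm closure of the union of all local algebras. -/
def quasiLocal (p d : ℕ) [Fact p.Prime] : StarSubalgebra ℂ (Op p d) :=
  (⨆ U : Finset (Lattice d), localAlgebra p U).topologicalClosure

theorem localEmbed_mem (U : Finset (Lattice d)) (M : LocalMatrix p U) :
    localEmbed U M ∈ quasiLocal p d :=
  StarSubalgebra.le_topologicalClosure _ (le_iSup (fun U => localAlgebra p U) U ⟨M, rfl⟩)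

/-! ### Lattice translations of the quasi-local algebra -/

/-- Translation of configurations, `(τ_x q)(y) = q(y - x)`. -/
def shiftConfig (x : Lattice d) : Config p d ≃ Config p d where
  toFun q := fun y => q (y - x)
  invFun q := fun y => q (y + x)
  left_inv q := by funext y; simp
  right_inv q := by funext y; simp

/-- Conjugation of operators with the unitary `|q⟩ ↦ |τ_x q⟩`. -/
def shiftOp (x : Lattice d) : Op p d ≃⋆ₐ[ℂ] Op p d :=
  (permute (shiftConfig x)).conjStarAlgEquiv

theorem shiftOp_localEmbed_mem (x : Lattice d) (U : Finset (Lattice d)) (M : LocalMatrix p U) :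
    shiftOp x (localEmbed U M) ∈ localAlgebra p (U.image (· + x)) := by
  have hU : ∀ y, y ∈ U.image (· + x) ↔ y - x ∈ U := fun y => by
    simp only [Finset.mem_image]
    exact ⟨fun ⟨z, hz, h⟩ => by rw [← h, add_sub_cancel_right]; exact hz,
      fun h => ⟨y - x, h, sub_add_cancel y x⟩⟩
  let e : U ≃ (U.image (· + x) : Finset (Lattice d)) :=
    { toFun := fun y => ⟨y + x, (hU _).2 (by rw [add_sub_cancel_right]; exact y.2)⟩
      invFun := fun y => ⟨y - x, (hU _).1 y.2⟩
      left_inv := fun y => by simp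
      right_inv := fun y => by simp }
  let E : LocalConfig p (U.image (· + x)) ≃ LocalConfig p U := Equiv.arrowCongr e.symm (Equiv.refl _)
  refine ⟨Matrix.of fun r r' => M (E r) (E r'), ?_⟩
  ext f q
  change ampliate _ _ f q = ampliate U M ((permute (shiftConfig x)).symm f) ((shiftConfig x).symm q)
  rw [ampliate_apply, ampliate_apply, ← Equiv.sum_comp E]
  refine Finset.sum_congr rfl fun r _ => ?_
  have h1 : E (restrict (U.image (· + x)) q) = restrict U ((shiftConfig x).symm q) := by
    funext y; rfl
  have h2 : shiftConfig x (override U ((shiftConfig x).symm q) (E r))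
      = override (U.image (· + x)) q r := by
    funext y
    by_cases h : y - x ∈ U
    · have h' := (hU y).2 h
      simp only [shiftConfig, override, Equiv.coe_fn_mk, dif_pos h, dif_pos h']
      simp [E, e]
    · have h' := mt (hU y).1 h
      simp only [shiftConfig, override, Equiv.coe_fn_mk, Equiv.coe_fn_symm_mk, dif_neg h, dif_neg h']
      simp
  rw [Matrix.of_apply, h1, ← h2]
  rfl

theorem shiftOp_mem (x : Lattice d) {A : Op p d} (hA : A ∈ quasiLocal p d) :
    shiftOp x A ∈ quasiLocal p d := by
  have hc : Continuous (shiftOp x : Op p d → Op p d) :=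
    (permute (shiftConfig x)).toContinuousLinearEquiv.conjContinuousAlgEquiv.continuous
  let S : StarSubalgebra ℂ (Op p d) :=
    (quasiLocal p d).comap ((shiftOp x : Op p d ≃⋆ₐ[ℂ] Op p d) : Op p d →⋆ₐ[ℂ] Op p d)
  have hS : quasiLocal p d ≤ S := by
    refine StarSubalgebra.topologicalClosure_minimal (iSup_le fun U => ?_) ?_
    · rintro _ ⟨M, rfl⟩
      exact StarSubalgebra.le_topologicalClosure _
        (le_iSup (fun U => localAlgebra p U) _ (shiftOp_localEmbed_mem x U M))
    · exact (StarSubalgebra.isClosed_topologicalClosure _).preimage hc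
  exact hS hA

/-- The translation automorphism `τ_x` of the quasi-local algebra, which moves an operator at the
cell `y` to the cell `y + x`. -/
def translate (x : Lattice d) : quasiLocal p d →⋆ₐ[ℂ] quasiLocal p d :=
  (((shiftOp x : Op p d ≃⋆ₐ[ℂ] Op p d) : Op p d →⋆ₐ[ℂ] Op p d).comp
    (quasiLocal p d).subtype).codRestrict (quasiLocal p d) (fun A => shiftOp_mem x A.2)

/-! ### Quantum cellular automata -/

/-- A *-automorphism `α` of the quasi-local algebra is a translation-invariant reversible quantum
cellular automaton if it maps each cell algebra `𝔄({x})` into the local algebra of a finite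
neighbourhood `N + x` and commutes with all lattice translations. -/
structure IsQCA (α : quasiLocal p d ≃⋆ₐ[ℂ] quasiLocal p d) : Prop where
  locality : ∃ N : Finset (Lattice d), ∀ (x : Lattice d) (A : quasiLocal p d),
    (A : Op p d) ∈ localAlgebra p {x} → (α A : Op p d) ∈ localAlgebra p (N.image (· + x))
  translation_invariant : ∀ (x : Lattice d) (A : quasiLocal p d),
    α (translate x A) = translate x (α A)

/-! ### Phase space -/

/-- The ring `D_{p,d}` of finitely supported functions `ℤ^d → 𝔽_p` with convolution as product. -/
abbrev ConvRing (p d : ℕ) : Type := AddMonoidAlgebra (ZMod p) (Lattice d)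

/-- The phase space `D_{p,d}²`; `ξ 0` and `ξ 1` are the components `ξ₊` and `ξ₋`. -/
abbrev PhaseSpace (p d : ℕ) : Type := Fin 2 → ConvRing p d

/-- Translation of phase space vectors, `(τ_y ξ)(x) = ξ(x - y)`; see `shift_coeff`. -/
def shift (y : Lattice d) (ξ : PhaseSpace p d) : PhaseSpace p d :=
  fun i => AddMonoidAlgebra.single y 1 * ξ i

theorem shift_coeff (y : Lattice d) (ξ : PhaseSpace p d) (i : Fin 2) (x : Lattice d) :
    (shift y ξ i).coeff x = (ξ i).coeff (x - y) := by
  rw [shift, AddMonoidAlgebra.coeff_single_mul_apply, one_mul]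
  congr 1
  abel

/-- The convolution `s ⋆ ξ` of a matrix over `D_{p,d}` with a phase space vector. -/
def conv (s : Matrix (Fin 2) (Fin 2) (ConvRing p d)) (ξ : PhaseSpace p d) : PhaseSpace p d :=
  s.mulVec ξ

/-- The support of a phase space vector. -/
def PhaseSpace.support (ξ : PhaseSpace p d) : Finset (Lattice d) :=
  (ξ 0).coeff.support ∪ (ξ 1).coeff.support

/-- The form `β(ξ, η) = -∑_x ξ₊(x) η₋(x)`. -/
def beta (ξ η : PhaseSpace p d) : ZMod p :=
  -∑ x ∈ ξ.support, (ξ 0).coeff x * (η 1).coeff x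

/-- The symplectic form `σ(ξ, η) = β(ξ, η) - β(η, ξ)`. -/
def sigma (ξ η : PhaseSpace p d) : ZMod p :=
  beta ξ η - beta η ξ

/-! ### Weyl operators and Clifford quantum cellular automata -/

/-- The power `ε^a` of a `p`-th root of unity `ε` for `a ∈ 𝔽_p`. -/
def rootPow (ε : ℂ) (a : ZMod p) : ℂ := ε ^ a.val

/-- The single-cell Weyl operator `w(a, b)|q⟩ = ε^{a q} |q + b⟩` on `ℂ^p`. -/
def weylCell (ε : ℂ) (a b : ZMod p) : Matrix (ZMod p) (ZMod p) ℂ :=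
  Matrix.of fun r q => if r = q + b then rootPow ε (a * q) else 0

/-- The Weyl operator `w(ξ) = ⨂_x w(ξ₊(x), ξ₋(x))` in the quasi-local algebra. -/
def weyl (ε : ℂ) (ξ : PhaseSpace p d) : quasiLocal p d :=
  ⟨localEmbed ξ.support
    (tensor ξ.support fun x => weylCell ε ((ξ 0).coeff x) ((ξ 1).coeff x)), localEmbed_mem _ _⟩

/-- A Clifford quantum cellular automaton: a translation-invariant reversible quantum cellular
automaton that maps Weyl operators to multiples of Weyl operators. -/
structure IsCQCA (ε : ℂ) (α : quasiLocal p d ≃⋆ₐ[ℂ] quasiLocal p d) : Prop extends IsQCA α where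
  map_weyl : ∀ ξ : PhaseSpace p d, ∃ (c : ℂ) (η : PhaseSpace p d), α (weyl ε ξ) = c • weyl ε η

end CQCA

end

open scoped BigOperators

noncomputable section

namespace CQCA

variable {p d : ℕ}

/-! The point is uniqueness: if a nonzero multiple of one Weyl operator is a multiple of another,
the two scalars and the two phase space vectors agree (`smul_weyl_inj`). Hence in `α (w ξ) = c(ξ)
w(S ξ)` both `c` and `S` are determined by `α`, and every identity respected by `α` splits into one
for `c` and one for `S`. The Weyl relation (`weyl_add`) makes `S` additive and gives the cocycle
rule for `c`; commuting with translations (`translate_weyl`) makes `S` equivariant and `c`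
invariant; `w(ξ)* w(ξ) = 1` gives `|c| = 1`.

An additive equivariant map is linear over the convolution ring, hence a matrix (`exists_conv_eq`).
Its entries have finite support because `S` takes values in the phase space. The symplectic property
is the antisymmetric part of the cocycle rule, as `ε` is primitive. -/

/-- The pairing `∑_x f(x) q(x)` of a finitely supported function with a configuration. -/
def pairing (f : ConvRing p d) (q : Config p d) : ZMod p :=
  Finsupp.linearCombination (ZMod p) q f.coeff

theorem pairing_eq_sum (f : ConvRing p d) (q : Config p d) {U : Finset (Lattice d)}
    (hU : f.coeff.support ⊆ U) : pairing f q = ∑ x ∈ U, f.coeff x * q x := by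
  rw [pairing, Finsupp.linearCombination_apply, Finsupp.sum_of_support_subset _ hU _ (by simp)]
  rfl

theorem pairing_add_left (f g : ConvRing p d) (q : Config p d) :
    pairing (f + g) q = pairing f q + pairing g q := by
  simp [pairing]

theorem pairing_add_right (f : ConvRing p d) (q q' : Config p d) :
    pairing f (q + q') = pairing f q + pairing f q' := by
  simp [pairing_eq_sum f _ subset_rfl, mul_add, Finset.sum_add_distrib]

theorem pairing_zero_right (f : ConvRing p d) : pairing f (0 : Config p d) = 0 := by
  simp [pairing_eq_sum f _ subset_rfl]

theorem pairing_single_right (f : ConvRing p d) (x : Lattice d) :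
    pairing f (Pi.single x 1) = f.coeff x := by
  classical
  rw [pairing_eq_sum f _ (Finset.subset_insert x _), Finset.sum_eq_single x]
  · simp
  · intro y _ hy
    simp [hy]
  · simp

theorem pairing_single_mul (x : Lattice d) (f : ConvRing p d) (q : Config p d) :
    pairing (AddMonoidAlgebra.single x 1 * f) q = pairing f ((shiftConfig x).symm q) := by
  induction f using AddMonoidAlgebra.induction_linear with
  | zero => simp [pairing]
  | add f g hf hg => rw [mul_add, pairing_add_left, pairing_add_left, hf, hg]
  | single y a =>
    rw [AddMonoidAlgebra.single_mul_single]
    simp [pairing, shiftConfig, add_comm]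

/-! ### The form `β` and powers of `ε` -/

variable [Fact p.Prime] {ε : ℂ}

theorem beta_eq_neg_pairing (ξ η : PhaseSpace p d) :
    beta ξ η = -pairing (ξ 0) (η 1).coeff := by
  rw [beta, pairing_eq_sum _ _ (U := ξ.support) Finset.subset_union_left]

theorem rootPow_zero (ε : ℂ) : rootPow ε (0 : ZMod p) = 1 := by
  simp [rootPow]

theorem rootPow_add (hε : IsPrimitiveRoot ε p) (a b : ZMod p) :
    rootPow ε (a + b) = rootPow ε a * rootPow ε b := by
  rw [rootPow, rootPow, rootPow, ZMod.val_add, ← pow_eq_pow_mod _ hε.pow_eq_one, pow_add]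

theorem rootPow_sum (hε : IsPrimitiveRoot ε p) {ι : Type*} (t : Finset ι) (a : ι → ZMod p) :
    rootPow ε (∑ i ∈ t, a i) = ∏ i ∈ t, rootPow ε (a i) := by
  classical
  induction t using Finset.induction_on with
  | empty => simp [rootPow_zero]
  | insert i t hi ih => rw [Finset.sum_insert hi, Finset.prod_insert hi, rootPow_add hε, ih]

theorem rootPow_injective (hε : IsPrimitiveRoot ε p) :
    Function.Injective (rootPow (p := p) ε) := fun a b h =>
  ZMod.val_injective p (hε.pow_inj (ZMod.val_lt a) (ZMod.val_lt b) h)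

theorem norm_rootPow (hε : IsPrimitiveRoot ε p) (a : ZMod p) : ‖rootPow ε a‖ = 1 := by
  rw [rootPow, norm_pow, hε.norm'_eq_one (Fact.out : p.Prime).ne_zero, one_pow]

theorem rootPow_ne_zero (hε : IsPrimitiveRoot ε p) (a : ZMod p) : rootPow ε a ≠ 0 :=
  norm_ne_zero_iff.1 (by rw [norm_rootPow hε]; exact one_ne_zero)

/-! ### Weyl operators acting on functions of configurations -/

/-- Weyl operators shift the configuration and multiply by a character. -/
theorem weyl_apply (hε : IsPrimitiveRoot ε p) (ξ : PhaseSpace p d) (f : Hilb p d)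
    (q : Config p d) :
    (weyl ε ξ : Op p d) f q
      = rootPow ε (pairing (ξ 0) (q - ⇑(ξ 1).coeff)) * f (q - ⇑(ξ 1).coeff) := by
  change ampliate ξ.support _ f q = _
  -- At each cell `x` the row `q x` of the Weyl matrix has its only nonzero entry in column `q x -
  -- ξ₋(x)`, so one summand survives.
  rw [ampliate_apply, Finset.sum_eq_single (restrict ξ.support (q - ⇑(ξ 1).coeff))]
  · congr 1
    · rw [pairing_eq_sum _ _ (U := ξ.support) Finset.subset_union_left, rootPow_sum hε,
        ← Finset.prod_coe_sort]
      simp [tensor, weylCell, restrict]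
    · refine congrArg (f : Config p d → ℂ) ?_
      funext x
      by_cases hx : x ∈ ξ.support
      · simp [override, restrict, hx]
      · have : (ξ 1).coeff x = 0 := by
          by_contra h
          exact hx (Finset.mem_union_right _ (Finsupp.mem_support_iff.2 h))
        simp [override, hx, this]
  · intro r _ hr
    obtain ⟨x, hx⟩ := Function.ne_iff.1 hr
    rw [tensor, Matrix.of_apply, Finset.prod_eq_zero (Finset.mem_univ x), zero_mul]
    rw [weylCell, Matrix.of_apply, if_neg]
    intro h
    apply hx
    change q x = _ at h
    simp [restrict, h]
  · simp

theorem quasiLocal_ext {A B : quasiLocal p d}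
    (h : ∀ (f : Hilb p d) (q : Config p d), (A : Op p d) f q = (B : Op p d) f q) : A = B :=
  Subtype.ext (ContinuousLinearMap.ext fun f => lp.ext (funext (h f)))

theorem smul_quasiLocal_apply (c : ℂ) (A : quasiLocal p d) (f : Hilb p d) (q : Config p d) :
    ((c • A : quasiLocal p d) : Op p d) f q = c * (A : Op p d) f q := rfl

theorem mul_quasiLocal_apply (A B : quasiLocal p d) (f : Hilb p d) :
    ((A * B : quasiLocal p d) : Op p d) f = (A : Op p d) ((B : Op p d) f) := rfl

theorem weyl_zero (hε : IsPrimitiveRoot ε p) : weyl ε (0 : PhaseSpace p d) = 1 := by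
  refine quasiLocal_ext fun f q => ?_
  rw [weyl_apply hε]
  simp [pairing, rootPow_zero]

theorem weyl_add (hε : IsPrimitiveRoot ε p) (ξ η : PhaseSpace p d) :
    weyl ε (ξ + η) = rootPow ε (beta ξ η) • (weyl ε ξ * weyl ε η) := by
  refine quasiLocal_ext fun f q => ?_
  rw [smul_quasiLocal_apply, mul_quasiLocal_apply, weyl_apply hε, weyl_apply hε, weyl_apply hε]
  have h1 : q - ⇑((ξ + η) 1).coeff = q - ⇑(ξ 1).coeff - ⇑(η 1).coeff := by
    rw [Pi.add_apply, AddMonoidAlgebra.coeff_add, Finsupp.coe_add, sub_sub]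
  -- In the product, the phase of `w(ξ)` is read before the shift by `η₋`. The excess `pairing ξ₊
  -- η₋` is `-β(ξ, η)`.
  have h2 : pairing (ξ 0) (q - ⇑(ξ 1).coeff)
      = pairing (ξ 0) (q - ⇑(ξ 1).coeff - ⇑(η 1).coeff) + pairing (ξ 0) (η 1).coeff := by
    rw [← pairing_add_right, sub_add_cancel]
  rw [h1, h2, Pi.add_apply, pairing_add_left, beta_eq_neg_pairing, ← mul_assoc, ← mul_assoc,
    ← rootPow_add hε, ← rootPow_add hε]
  congr 2
  abel

theorem weyl_mul (hε : IsPrimitiveRoot ε p) (ξ η : PhaseSpace p d) :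
    weyl ε ξ * weyl ε η = rootPow ε (-beta ξ η) • weyl ε (ξ + η) := by
  rw [weyl_add hε, smul_smul, ← rootPow_add hε, neg_add_cancel, rootPow_zero, one_smul]

theorem norm_weyl_apply (hε : IsPrimitiveRoot ε p) (ξ : PhaseSpace p d) (f : Hilb p d) :
    ‖(weyl ε ξ : Op p d) f‖ = ‖f‖ := by
  have h2 : (0 : ℝ) < (2 : ENNReal).toReal := by norm_num
  rw [lp.norm_eq_tsum_rpow h2, lp.norm_eq_tsum_rpow h2]
  congr 1
  simp only [weyl_apply hε, norm_mul, norm_rootPow hε, one_mul]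
  exact (Equiv.subRight ((ξ 1).coeff : Config p d)).tsum_eq
    (fun q => ‖f q‖ ^ (2 : ENNReal).toReal)

/-- Weyl operators are isometries, being a reindexing times unimodular phases. This is what later
forces the scalars to have modulus one. -/
theorem star_weyl_mul_weyl (hε : IsPrimitiveRoot ε p) (ξ : PhaseSpace p d) :
    star (weyl ε ξ) * weyl ε ξ = 1 :=
  Subtype.ext ((ContinuousLinearMap.norm_map_iff_adjoint_comp_self _).1 (norm_weyl_apply hε ξ))

/-- Distinct Weyl operators are not proportional. -/
theorem smul_weyl_inj (hε : IsPrimitiveRoot ε p) {c c' : ℂ} (hc : c ≠ 0) {ξ η : PhaseSpace p d}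
    (h : c • weyl ε ξ = c' • weyl ε η) : c = c' ∧ ξ = η := by
  classical
  -- Apply both sides to `|q⟩` and read off the coefficient at `q + ξ₋`, the only one where the left
  -- side is nonzero.
  have key (q : Config p d) : c * rootPow ε (pairing (ξ 0) q)
      = c' * (rootPow ε (pairing (η 0) (q + ⇑(ξ 1).coeff - ⇑(η 1).coeff)) *
        (lp.single 2 q (1 : ℂ) : Hilb p d) (q + ⇑(ξ 1).coeff - ⇑(η 1).coeff)) := by
    have h1 := congrArg
      (fun A : quasiLocal p d => (A : Op p d) (lp.single 2 q (1 : ℂ)) (q + ⇑(ξ 1).coeff)) h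
    simp only [smul_quasiLocal_apply, weyl_apply hε, add_sub_cancel_right, lp.single_apply_self,
      mul_one] at h1
    exact h1
  have h1 : ((ξ 1).coeff : Config p d) = (η 1).coeff := by
    by_contra hne
    have h0 := key 0
    rw [lp.single_apply_ne, mul_zero, mul_zero] at h0
    · exact mul_ne_zero hc (rootPow_ne_zero hε _) h0
    · rw [zero_add]
      exact sub_ne_zero.2 hne
  have key' (q : Config p d) :
      c * rootPow ε (pairing (ξ 0) q) = c' * rootPow ε (pairing (η 0) q) := by
    have := key q
    rwa [h1, add_sub_cancel_right, lp.single_apply_self, mul_one] at this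
  have hcc : c = c' := by
    simpa [pairing_zero_right, rootPow_zero] using key' 0
  refine ⟨hcc, funext fun i => AddMonoidAlgebra.ext ?_⟩
  match i with
  | 0 =>
    ext x
    -- The configuration `q = 0` has fixed the scalar; unit configurations now recover `ξ₊` cell by
    -- cell.
    have := key' (Pi.single x 1)
    rw [← hcc, pairing_single_right, pairing_single_right] at this
    exact rootPow_injective hε (mul_left_cancel₀ hc this)
  | 1 => exact DFunLike.coe_injective h1

/-! ### Translations and equivariant maps -/

theorem translate_weyl (hε : IsPrimitiveRoot ε p) (x : Lattice d) (ξ : PhaseSpace p d) :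
    translate x (weyl ε ξ) = weyl ε (shift x ξ) := by
  refine quasiLocal_ext fun f q => ?_
  have hs : (shiftConfig x).symm (q - ⇑(shift x ξ 1).coeff)
      = (shiftConfig x).symm q - ⇑(ξ 1).coeff := by
    funext y
    simp [shiftConfig, shift_coeff]
  have hl : ((translate x (weyl ε ξ) : quasiLocal p d) : Op p d) f q
      = (weyl ε ξ : Op p d) ((permute (shiftConfig x)).symm f) ((shiftConfig x).symm q) := rfl
  have hr (g : Config p d) : f g = (permute (shiftConfig x)).symm f ((shiftConfig x).symm g) := by
    change f g = f (shiftConfig x ((shiftConfig x).symm g))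
    rw [Equiv.apply_symm_apply]
  rw [hl, weyl_apply hε, weyl_apply hε, hr, hs]
  congr 2
  rw [shift, pairing_single_mul, ← hs]

/-- A translation-equivariant additive map on phase space is the convolution with a matrix. -/
theorem exists_conv_eq (S : PhaseSpace p d →+ PhaseSpace p d)
    (hS : ∀ x ξ, S (shift x ξ) = shift x (S ξ)) :
    ∃ s : Matrix (Fin 2) (Fin 2) (ConvRing p d), ∀ ξ, conv s ξ = S ξ := by
  have hsmul (f : ConvRing p d) (ξ : PhaseSpace p d) : S (f • ξ) = f • S ξ := by
    induction f using AddMonoidAlgebra.induction_linear with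
    | zero => simp
    | add f g hf hg => rw [add_smul, add_smul, map_add, hf, hg]
    | single y a =>
      -- Every scalar in `𝔽_p` is a sum of ones, so a monomial acts as a repeated sum of one shift;
      -- additivity and equivariance suffice.
      have h1 (ζ : PhaseSpace p d) :
          (AddMonoidAlgebra.single y a : ConvRing p d) • ζ = a.val • shift y ζ := by
        have : (AddMonoidAlgebra.single y a : ConvRing p d)
            = a.val • AddMonoidAlgebra.single y 1 := by
          rw [AddMonoidAlgebra.smul_single, nsmul_one, ZMod.natCast_zmod_val]
        rw [this, smul_assoc]
        rfl
      rw [h1, h1, map_nsmul, hS]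
  refine ⟨LinearMap.toMatrix' { S with map_smul' := hsmul }, fun ξ => ?_⟩
  exact LinearMap.toMatrix'_mulVec _ ξ

end CQCA

end

/-! ### The structure theorem -/

theorem mainTheorem1 (p d : ℕ) [Fact p.Prime] (ε : ℂ) (hε : IsPrimitiveRoot ε p)
    (α : CQCA.quasiLocal p d ≃⋆ₐ[ℂ] CQCA.quasiLocal p d) (hα : CQCA.IsCQCA ε α) :
    ∃ (s : Matrix (Fin 2) (Fin 2) (CQCA.ConvRing p d)) (φ : CQCA.PhaseSpace p d → Circle),
      (∀ (x : CQCA.Lattice d) (ξ : CQCA.PhaseSpace p d), φ (CQCA.shift x ξ) = φ ξ) ∧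
      (∀ ξ : CQCA.PhaseSpace p d,
        α (CQCA.weyl ε ξ) = (φ ξ : ℂ) • CQCA.weyl ε (CQCA.conv s ξ)) ∧
      (∀ ξ η : CQCA.PhaseSpace p d,
        (φ (ξ + η) : ℂ) =
          CQCA.rootPow ε (CQCA.beta ξ η - CQCA.beta (CQCA.conv s ξ) (CQCA.conv s η)) *
            φ ξ * φ η) ∧
      (∀ ξ η : CQCA.PhaseSpace p d,
        CQCA.sigma (CQCA.conv s ξ) (CQCA.conv s η) = CQCA.sigma ξ η) := by
  open CQCA in
  choose c S hcS using hα.map_weyl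
  have hnorm (ξ : PhaseSpace p d) : ‖c ξ‖ = 1 := by
    have h1 : α (star (weyl ε ξ) * weyl ε ξ) = 1 := by rw [star_weyl_mul_weyl hε, map_one]
    have hstar : α (star (weyl ε ξ)) = star (α (weyl ε ξ)) := α.map_star' _
    rw [map_mul, hstar, hcS, star_smul, smul_mul_smul_comm, star_weyl_mul_weyl hε,
      ← weyl_zero hε] at h1
    -- Writing `1` as `w(0)` makes `|c(ξ)|² = 1` an instance of uniqueness.
    have h2 : (1 : ℂ) • weyl ε (0 : PhaseSpace p d) = (star (c ξ) * c ξ) • weyl ε 0 := by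
      rw [one_smul, h1]
    have h3 := congrArg norm (smul_weyl_inj hε one_ne_zero h2).1
    rw [norm_one, norm_mul, norm_star, ← sq] at h3
    exact (pow_eq_one_iff_of_nonneg (norm_nonneg _) two_ne_zero).1 h3.symm
  have hne (ξ : PhaseSpace p d) : c ξ ≠ 0 := norm_ne_zero_iff.1 (by rw [hnorm]; exact one_ne_zero)
  have hadd (ξ η : PhaseSpace p d) :
      c (ξ + η) = rootPow ε (beta ξ η - beta (S ξ) (S η)) * c ξ * c η ∧
        S (ξ + η) = S ξ + S η := by
    refine smul_weyl_inj hε (hne _) ?_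
    rw [← hcS, weyl_add hε, map_smul, map_mul, hcS, hcS, smul_mul_smul_comm, weyl_mul hε,
      smul_smul, smul_smul, sub_eq_add_neg, rootPow_add hε]
    congr 1
    ring
  have hshift (x : Lattice d) (ξ : PhaseSpace p d) :
      c (shift x ξ) = c ξ ∧ S (shift x ξ) = shift x (S ξ) := by
    refine smul_weyl_inj hε (hne _) ?_
    rw [← hcS, ← translate_weyl hε, hα.translation_invariant, hcS, map_smul, translate_weyl hε]
  obtain ⟨s, hs⟩ := exists_conv_eq (AddMonoidHom.mk' S fun ξ η => (hadd ξ η).2)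
    fun x ξ => (hshift x ξ).2
  have hs' (ξ : PhaseSpace p d) : conv s ξ = S ξ := hs ξ
  refine ⟨s, fun ξ => ⟨c ξ, mem_sphere_zero_iff_norm.2 (hnorm ξ)⟩,
    fun x ξ => Subtype.ext (hshift x ξ).1, fun ξ => ?_, fun ξ η => ?_, fun ξ η => ?_⟩
  · rw [hs']
    exact hcS ξ
  · rw [hs', hs']
    exact (hadd ξ η).1
  · rw [hs', hs']
    have h1 := (hadd ξ η).1
    -- Exchanging `ξ` and `η` leaves `c(ξ + η)` unchanged, so the two cocycle exponents agree in
    -- `𝔽_p`.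
    rw [add_comm ξ η, (hadd η ξ).1, mul_right_comm] at h1
    have h2 := rootPow_injective hε (mul_right_cancel₀ (hne ξ) (mul_right_cancel₀ (hne η) h1))
    rw [sigma, sigma]
    linear_combination h2
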